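/- Let $(X,d)$ be a compact metric space, $f : X \to X$ a Borel measurable map and $\mu$ an $f$-invariant Borel probability measure on $X$. Let $\mathcal{M}$ be the set of Borel probability measures on $X$, endowed with the Wasserstein distance $W_1(\nu_1,\nu_2) = \sup_{\phi} \int \phi \, d(\nu_1-\nu_2)$, the supremum being over all $1$-Lipschitz functions $\phi : X \to \mathbb{R}$ (it induces the weak-$*$ topology), and let $\mathcal{M}_f \subset \mathcal{M}$ be the subset of $f$-invariant measures. Let $e_f(x) := \lim_{n\to\infty} \frac1n \sum_{k=0}^{n-1} \delta_{f^k(x)}$ be the weak-$*$ limit of the empirical measures; by Birkhoff's theorem it exists for $\mu$-almost every $x \in X$. Let $\mu_{e_f} := (e_f)_* \mu$ be the ergodic decomposition of $\mu$, a Borel probability measure on $\mathcal{M}$. The emergence of $\mu$ at $\epsilon > 0$ is \[ \mathcal{E}_\mu(\epsilon) = \min \Big\{ N \in \mathbb{N} : \exists\, \nu_1,\dots,\nu_N \in \mathcal{M}_f, \ \int_X \min_{1\le i\le N} W_1(e_f(x), \nu_i) \, d\mu(x) \le \epsilon \Big\} \] (where $N \ge 1$), and the emergence order of $\mu$ and the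 local order of its ergodic decomposition at $\nu \in \mathcal{M}$ are \[ \overline{\mathsf{ord}}\, \mathcal{E}_\mu = \limsup_{\epsilon\to 0} \frac{\log\log \mathcal{E}_\mu(\epsilon)}{-\log\epsilon}, \qquad \overline{\mathsf{ord}}\, \mathcal{E}^{\mathrm{loc}}_\mu(\nu) = \limsup_{\epsilon\to 0} \frac{\log\big(-\log \mu_{e_f}(B(\nu,\epsilon))\big)}{-\log\epsilon}, \] both in $[-\infty,+\infty]$ with $\log 0 = -\infty$, $\log(+\infty) = +\infty$, where $B(\nu,\epsilon)$ is the open $W_1$-ball. Then for $\mu_{e_f}$-almost every $\nu \in \mathcal{M}$, \[ \overline{\mathsf{ord}}\, \mathcal{E}^{\mathrm{loc}}_\mu(\nu) \le \overline{\mathsf{ord}}\, \mathcal{E}_\mu . \] -/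

import Mathlib

open MeasureTheory Filter Topology
open scoped ENNReal NNReal

noncomputable section

namespace ErgodicEmergence

variable {X : Type*} [MeasurableSpace X]

/-- The empirical measure `(1 / (n + 1)) ∑_{k < n + 1} δ_{f^k x}` as a probability measure. -/
def empirical (f : X → X) (n : ℕ) (x : X) : ProbabilityMeasure X :=
  ⟨((n + 1 : ℕ) : ℝ≥0∞)⁻¹ • ∑ k ∈ Finset.range (n + 1), Measure.dirac (f^[k] x), ⟨by
    simp only [Measure.smul_apply, Measure.finsetSum_apply, measure_univ, Finset.sum_const,
      Finset.card_range, smul_eq_mul, nsmul_eq_mul, mul_one]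
    exact ENNReal.inv_mul_cancel (by simp) (ENNReal.natCast_ne_top _)⟩⟩

lemma measurable_empirical {f : X → X} (hf : Measurable f) (n : ℕ) :
    Measurable (empirical f n) := by
  refine Measurable.subtype_mk ?_
  refine Measure.measurable_of_measurable_coe _ fun s hs => ?_
  simp only [Measure.smul_apply, Measure.finsetSum_apply, smul_eq_mul]
  refine Measurable.const_mul (Finset.measurable_sum _ fun k _ => ?_) _
  exact (Measure.measurable_coe hs).comp (Measure.measurable_dirac.comp (hf.iterate k))

section Limit

variable [MetricSpace X] [CompactSpace X] [BorelSpace X]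

open Classical in
/-- `e_f(x)`, the weak-* limit of the empirical measures of the orbit of `x`. For every invariant
probability measure the limit exists at almost every point (Birkhoff); at the remaining points,
where it does not exist, the value is irrelevant and is set to `δ_x`. The limit is unique because
the space of probability measures is Hausdorff. -/
def empiricalLimit (f : X → X) (x : X) : ProbabilityMeasure X :=
  if h : ∃ ν : ProbabilityMeasure X, Tendsto (fun n => empirical f n x) atTop (𝓝 ν) then h.choose
  else diracProba x

/-- Weak-* open sets are measurable for the canonical σ-algebra on probability measures. -/
lemma opensMeasurableSpace_probabilityMeasure : OpensMeasurableSpace (ProbabilityMeasure X) := by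
  have : SecondCountableTopology (ProbabilityMeasure X) := by
    let := TopologicalSpace.metrizableSpaceMetric (ProbabilityMeasure X)
    infer_instance
  have hmeas : ∀ φ : BoundedContinuousFunction X ℝ≥0, Measurable
      fun ν : ProbabilityMeasure X => ν.toFiniteMeasure.testAgainstNN φ := fun φ =>
    ((Measure.measurable_lintegral φ.measurable_coe_ennreal_comp).comp
      measurable_subtype_coe).ennreal_toNNReal
  have htop : (inferInstance : TopologicalSpace (ProbabilityMeasure X)) =
      ⨅ φ : BoundedContinuousFunction X ℝ≥0, TopologicalSpace.induced
        (fun ν : ProbabilityMeasure X => ν.toFiniteMeasure.testAgainstNN φ) inferInstance := by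
    refine TopologicalSpace.ext_nhds fun ν => ?_
    rw [nhds_iInf, iInf_congr fun φ : BoundedContinuousFunction X ℝ≥0 => nhds_induced
      (fun ν : ProbabilityMeasure X => ν.toFiniteMeasure.testAgainstNN φ) ν]
    refine le_antisymm (le_iInf fun φ => ?_) ?_
    · exact tendsto_iff_comap.1
        (ProbabilityMeasure.continuous_testAgainstNN_eval φ).continuousAt
    · refine (tendsto_id' (x := ⨅ φ : BoundedContinuousFunction X ℝ≥0, _)).1 ?_
      refine ProbabilityMeasure.tendsto_iff_forall_lintegral_tendsto.2 fun φ => ?_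
      have h := (ENNReal.continuous_coe.tendsto _).comp
        (tendsto_comap.mono_left (iInf_le (fun φ : BoundedContinuousFunction X ℝ≥0 => comap
          (fun ν : ProbabilityMeasure X => ν.toFiniteMeasure.testAgainstNN φ)
          (𝓝 (ν.toFiniteMeasure.testAgainstNN φ))) φ))
      simp only [Function.comp_def, FiniteMeasure.testAgainstNN_coe_eq] at h
      exact h
  rw [← generateFrom_iUnion_isOpen] at htop
  refine ⟨?_⟩
  rw [borel_eq_generateFrom_of_subbasis htop]
  refine MeasurableSpace.generateFrom_le fun s hs => ?_
  obtain ⟨φ, U, hU, rfl⟩ := Set.mem_iUnion.1 hs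
  exact hmeas φ hU.measurableSet

lemma measurable_empiricalLimit {f : X → X} (hf : Measurable f) :
    Measurable (empiricalLimit f) := by
  classical
  have := opensMeasurableSpace_probabilityMeasure (X := X)
  have : SecondCountableTopology (ProbabilityMeasure X) := by
    let := TopologicalSpace.metrizableSpaceMetric (ProbabilityMeasure X)
    infer_instance
  have : TopologicalSpace.IsCompletelyPseudoMetrizableSpace (ProbabilityMeasure X) := by
    let := TopologicalSpace.metrizableSpaceMetric (ProbabilityMeasure X)
    infer_instance
  have hE : MeasurableSet {x | ∃ ν, Tendsto (fun n => empirical f n x) atTop (𝓝 ν)} :=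
    measurableSet_exists_tendsto (measurable_empirical hf)
  set E := {x | ∃ ν, Tendsto (fun n => empirical f n x) atTop (𝓝 ν)} with hEdef
  let g : ℕ → X → ProbabilityMeasure X := fun n x => if x ∈ E then empirical f n x else diracProba x
  have hg : ∀ n, Measurable (g n) := fun n =>
    Measurable.ite hE (measurable_empirical hf n) (Measurable.subtype_mk Measure.measurable_dirac)
  have hlim : ∀ x, Tendsto (fun n => g n x) atTop (𝓝 (empiricalLimit f x)) := fun x => by
    by_cases h : x ∈ E
    · have h' : ∃ ν, Tendsto (fun n => empirical f n x) atTop (𝓝 ν) := h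
      simp only [g, if_pos h, empiricalLimit, dif_pos h']
      exact h'.choose_spec
    · have h' : ¬ ∃ ν, Tendsto (fun n => empirical f n x) atTop (𝓝 ν) := h
      simp only [g, if_neg h, empiricalLimit, dif_neg h']
      exact tendsto_const_nhds
  have hint : ∀ φ : BoundedContinuousFunction X ℝ≥0,
      Measurable fun x => ∫⁻ y, φ y ∂(empiricalLimit f x : Measure X) := fun φ =>
    measurable_of_tendsto_metrizable
      (fun n => (Measure.measurable_lintegral φ.measurable_coe_ennreal_comp).comp
        (measurable_subtype_coe.comp (hg n)))
      (tendsto_pi_nhds.2 fun x =>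
        ProbabilityMeasure.tendsto_iff_forall_lintegral_tendsto.1 (hlim x) φ)
  have hmain : Measurable fun x => (empiricalLimit f x : Measure X) := by
    refine Measurable.measure_of_isPiSystem_of_isProbabilityMeasure
      (S := {s : Set X | IsClosed s}) ?_ isPiSystem_isClosed fun F hF => ?_
    · rw [← borel_eq_generateFrom_isClosed]
      exact BorelSpace.measurable_eq
    · exact measurable_of_tendsto_metrizable (fun n => hint (IsClosed.apprSeq hF n))
        (tendsto_pi_nhds.2 fun x => HasOuterApproxClosed.tendsto_lintegral_apprSeq hF _)
  exact hmain.subtype_mk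

/-- The ergodic decomposition of `μ`: the push-forward of `μ` under `e_f`, a probability measure on
the space of probability measures of `X`. -/
def ergodicDecomposition (f : X → X) (hf : Measurable f) (μ : ProbabilityMeasure X) :
    ProbabilityMeasure (ProbabilityMeasure X) :=
  μ.map (measurable_empiricalLimit hf).aemeasurable

/-- The Wasserstein distance `W₁(ν₁, ν₂) = sup_φ ∫ φ d(ν₁ - ν₂)` over the 1-Lipschitz functions. -/
def W₁ (ν₁ ν₂ : ProbabilityMeasure X) : ℝ≥0∞ :=
  ⨆ φ : {φ : X → ℝ // LipschitzWith 1 φ},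
    ENNReal.ofReal (∫ x, φ.1 x ∂(ν₁ : Measure X) - ∫ x, φ.1 x ∂(ν₂ : Measure X))

/-- The emergence of `μ` at scale `ε`: the least `N` such that some `N` invariant probability
measures are on average `ε`-close to `e_f(x)`. For `N = 0` the distance to the empty family is
`∞`, so that `N = 0` never qualifies. -/
def emergence (f : X → X) (μ : ProbabilityMeasure X) (ε : ℝ) : ℕ∞ :=
  ⨅ (N : ℕ) (_ : ∃ ν : Fin N → ProbabilityMeasure X,
      (∀ i, MeasurePreserving f (ν i : Measure X) (ν i : Measure X)) ∧
      ∫⁻ x, (⨅ i, W₁ (empiricalLimit f x) (ν i)) ∂(μ : Measure X) ≤ ENNReal.ofReal ε), (N : ℕ∞)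

/-- The emergence order `limsup_{ε → 0} log log 𝓔_μ(ε) / (- log ε)`, in `[-∞, ∞]`, with
`log 0 = -∞`. -/
def emergenceOrder (f : X → X) (μ : ProbabilityMeasure X) : EReal :=
  limsup (fun ε : ℝ =>
    ENNReal.log (ENNReal.log (emergence f μ ε : ℝ≥0∞)).toENNReal / ((-Real.log ε : ℝ) : EReal))
    (𝓝[>] 0)

/-- The local order `limsup_{ε → 0} log (- log μ_{e_f}(B(ν, ε))) / (- log ε)` at `ν`, in
`[-∞, ∞]`, with `log 0 = -∞`; `B(ν, ε)` is the open `W₁`-ball. -/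
def localOrder (f : X → X) (hf : Measurable f) (μ ν : ProbabilityMeasure X) : EReal :=
  limsup (fun ε : ℝ =>
    ENNReal.log (-ENNReal.log ((ergodicDecomposition f hf μ : Measure (ProbabilityMeasure X))
      {ν' | W₁ ν ν' < ENNReal.ofReal ε})).toENNReal / ((-Real.log ε : ℝ) : EReal))
    (𝓝[>] 0)

end Limit

end ErgodicEmergence

end

open MeasureTheory Filter Topology
open scoped ENNReal NNReal

namespace ErgodicEmergence

/-! Let `m` be the ergodic decomposition and suppose the emergence order is `< s`. For `b > 1`, some
`N k ≤ exp (exp (s b k))` centers approximate `m` up to `exp (-b k)` on average. By Markov, all but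
`exp (-(b - 1) k)` of the mass is `exp (-k)`-close to a center. Centers whose `exp (-k)`-ball has
mass below `exp (-k) / N k` cover at most `exp (-k)` in total. Both errors are summable, so by
Borel–Cantelli almost every `ν` is eventually close to a heavy center
(`ae_eventually_exists_center`). By the triangle inequality the ball of radius `2 exp (-k)` at `ν`
then has mass at least `exp (-k - exp (s b k))`, so the local order is at most any `t > s b`.

This needs `s > 0`. If the order is negative, then `N k ≤ 1` eventually, which forces `m` to be
concentrated at `W₁`-distance zero from almost every `ν`, and the local order is `-∞`. -/

lemma ae_eventually_of_measure_le {α : Type*} [MeasurableSpace α] {m : Measure α}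
    {P : ℕ → α → Prop} {u : ℕ → ℝ≥0∞} (hu : ∑' k, u k ≠ ∞)
    (h : ∀ᶠ k in atTop, m {x | ¬ P k x} ≤ u k) : ∀ᵐ x ∂m, ∀ᶠ k in atTop, P k x := by
  classical
  -- The finitely many indices where the bound may fail are discarded before applying
  -- Borel–Cantelli.
  let s : ℕ → Set α := fun k => if m {x | ¬ P k x} ≤ u k then {x | ¬ P k x} else ∅
  have hs : ∀ k, m (s k) ≤ u k := fun k => by
    by_cases hk : m {x | ¬ P k x} ≤ u k
    · simpa only [s, if_pos hk] using hk
    · simp only [s, if_neg hk, measure_empty, zero_le]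
  filter_upwards [ae_eventually_notMem (ne_top_of_le_ne_top hu (ENNReal.tsum_le_tsum hs))] with x hx
  filter_upwards [hx, h] with k hk hk'
  simpa only [s, if_pos hk', Set.mem_ofPred_eq, not_not] using hk

lemma tsum_ofReal_exp_neg_mul_ne_top {a : ℝ} (ha : 0 < a) :
    ∑' k : ℕ, ENNReal.ofReal (Real.exp (-(a * k))) ≠ ∞ := by
  have h : Summable fun k : ℕ => Real.exp (-(a * k)) := by
    simpa [mul_comm] using Real.summable_exp_nat_mul_iff.2 (neg_lt_zero.2 ha)
  exact h.tsum_ofReal_ne_top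

/-- After division by `exp (t * k)` the left side tends to `0`. The shift by `2` pays for rounding a
real scale `x` up to the integer `⌈x⌉₊ + 1`. -/
lemma eventually_add_exp_le_exp {c t : ℝ} (hct : c < t) (ht : 0 < t) :
    ∀ᶠ k : ℕ in atTop, (k : ℝ) + Real.exp (c * k) ≤ Real.exp (t * (k - 2)) := by
  have h1 : Tendsto (fun k : ℕ => (k : ℝ) * Real.exp (-t) ^ k) atTop (𝓝 0) :=
    tendsto_self_mul_const_pow_of_lt_one (Real.exp_pos _).le (by simpa using ht)
  have h2 : Tendsto (fun k : ℕ => Real.exp (c - t) ^ k) atTop (𝓝 0) :=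
    tendsto_pow_atTop_nhds_zero_of_lt_one (Real.exp_pos _).le (by simpa using hct)
  have h3 := h1.add h2
  rw [add_zero] at h3
  filter_upwards [h3.eventually_lt_const (Real.exp_pos (-(2 * t)))] with k hk
  rw [← Real.exp_nat_mul, ← Real.exp_nat_mul] at hk
  have h4 := mul_le_mul_of_nonneg_right hk.le (Real.exp_pos (t * k)).le
  rw [add_mul, mul_assoc, ← Real.exp_add, ← Real.exp_add, ← Real.exp_add] at h4
  ring_nf at h4 ⊢
  simpa using h4

/-! ### The Wasserstein distance and the scales `exp (-x)` -/

variable {X : Type*} [MeasurableSpace X] [MetricSpace X]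

lemma W₁_comm (ν₁ ν₂ : ProbabilityMeasure X) : W₁ ν₁ ν₂ = W₁ ν₂ ν₁ := by
  have key : ∀ ν₁ ν₂ : ProbabilityMeasure X, W₁ ν₁ ν₂ ≤ W₁ ν₂ ν₁ := fun ν₁ ν₂ => by
    refine iSup_le fun φ => ?_
    refine le_iSup_of_le ⟨-φ.1, φ.2.neg⟩ (le_of_eq ?_)
    simp only [Pi.neg_apply, integral_neg]
    congr 1
    ring
  exact le_antisymm (key _ _) (key _ _)

lemma W₁_triangle (ν₁ ν₂ ν₃ : ProbabilityMeasure X) : W₁ ν₁ ν₃ ≤ W₁ ν₁ ν₂ + W₁ ν₂ ν₃ := by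
  refine iSup_le fun φ => ?_
  rw [← sub_add_sub_cancel _ (∫ x, φ.1 x ∂(ν₂ : Measure X))]
  exact ENNReal.ofReal_add_le.trans (add_le_add (le_iSup (fun φ : {φ : X → ℝ // LipschitzWith 1 φ} =>
    ENNReal.ofReal (∫ x, φ.1 x ∂(ν₁ : Measure X) - ∫ x, φ.1 x ∂(ν₂ : Measure X))) φ)
    (le_iSup (fun φ : {φ : X → ℝ // LipschitzWith 1 φ} =>
    ENNReal.ofReal (∫ x, φ.1 x ∂(ν₂ : Measure X) - ∫ x, φ.1 x ∂(ν₃ : Measure X))) φ))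

variable [BorelSpace X]

lemma tendsto_exp_neg_nhdsGT_zero : Tendsto (fun x : ℝ => Real.exp (-x)) atTop (𝓝[>] 0) :=
  Real.tendsto_exp_atBot_nhdsGT.comp tendsto_neg_atTop_atBot

lemma eventually_emergence_le {f : X → X} {μ : ProbabilityMeasure X} {s : ℝ}
    (h : emergenceOrder f μ < s) : ∀ᶠ x : ℝ in atTop,
      (emergence f μ (Real.exp (-x)) : ℝ≥0∞) ≤ ENNReal.ofReal (Real.exp (Real.exp (s * x))) := by
  filter_upwards [tendsto_exp_neg_nhdsGT_zero.eventually (eventually_lt_of_limsup_lt h),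
    eventually_gt_atTop 0] with x hx hx0
  rw [Real.log_exp, neg_neg, EReal.div_lt_iff (EReal.coe_pos.2 hx0) (EReal.coe_ne_top x),
    ← EReal.coe_mul, ← Real.log_exp (s * x), ← ENNReal.log_ofReal_of_pos (Real.exp_pos _),
    ENNReal.log_lt_log_iff, ← EReal.real_coe_toENNReal] at hx
  have h1 : ENNReal.log (emergence f μ (Real.exp (-x)) : ℝ≥0∞) ≤ (Real.exp (s * x) : ℝ) :=
    not_lt.1 fun h' => hx.not_ge (EReal.toENNReal_le_toENNReal h'.le)
  rwa [← Real.log_exp (Real.exp (s * x)), ← ENNReal.log_ofReal_of_pos (Real.exp_pos _),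
    ENNReal.log_le_log_iff] at h1

variable [CompactSpace X]

/-- By compactness each Lipschitz test function is bounded, so its integral is weak-* continuous;
the supremum is lower semicontinuous even though the family is uncountable. -/
lemma measurable_W₁_left (ν₂ : ProbabilityMeasure X) : Measurable fun ν₁ => W₁ ν₁ ν₂ := by
  have := opensMeasurableSpace_probabilityMeasure (X := X)
  refine LowerSemicontinuous.measurable (lowerSemicontinuous_iSup fun φ => ?_)
  refine Continuous.lowerSemicontinuous (ENNReal.continuous_ofReal.comp ?_)
  exact (ProbabilityMeasure.continuous_integral_boundedContinuousFunction
    (BoundedContinuousFunction.mkOfCompact ⟨φ.1, φ.2.continuous⟩)).sub continuous_const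

/-- If `N` centers approximate `m` up to `ε` on average, then outside a set of measure at most
`ε / r + τ` every point is `r`-close to a center whose `r`-ball has mass at least `τ / N`. -/
lemma measure_not_exists_center_le (m : Measure (ProbabilityMeasure X)) {N : ℕ}
    (c : Fin N → ProbabilityMeasure X) {ε r : ℝ≥0∞} (τ : ℝ≥0∞)
    (hc : ∫⁻ ν, (⨅ i, W₁ ν (c i)) ∂m ≤ ε) (hr : r ≠ 0) (hr' : r ≠ ∞) :
    m {ν | ¬ ∃ i, W₁ ν (c i) < r ∧ τ / N ≤ m {ν' | W₁ ν' (c i) < r}} ≤ ε / r + τ := by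
  classical
  -- The light centers: there are at most `N` of them, so their balls have total mass at most `τ`.
  let I : Finset (Fin N) := Finset.univ.filter fun i => m {ν' | W₁ ν' (c i) < r} < τ / N
  have hsub : {ν | ¬ ∃ i, W₁ ν (c i) < r ∧ τ / N ≤ m {ν' | W₁ ν' (c i) < r}} ⊆
      {ν | r ≤ ⨅ i, W₁ ν (c i)} ∪ ⋃ i ∈ I, {ν | W₁ ν (c i) < r} := fun ν hν => by
    by_cases h : r ≤ ⨅ i, W₁ ν (c i)
    · exact Or.inl h
    · obtain ⟨i, hi⟩ := iInf_lt_iff.1 (not_le.1 h)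
      refine Or.inr (Set.mem_biUnion (x := i) ?_ hi)
      simp only [I, Finset.coe_filter, Finset.mem_univ, true_and, Set.mem_ofPred_eq]
      exact not_le.1 fun h' => hν ⟨i, hi, h'⟩
  refine (measure_mono hsub).trans ((measure_union_le _ _).trans (add_le_add ?_ ?_))
  · refine (meas_ge_le_lintegral_div
      (Measurable.iInf fun i => measurable_W₁_left (c i)).aemeasurable hr hr').trans ?_
    gcongr
  · calc m (⋃ i ∈ I, {ν | W₁ ν (c i) < r}) ≤ ∑ i ∈ I, m {ν | W₁ ν (c i) < r} :=
          measure_biUnion_finset_le _ _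
      _ ≤ ∑ _i ∈ I, τ / N := Finset.sum_le_sum fun i hi => (Finset.mem_filter.1 hi).2.le
      _ ≤ ∑ _i : Fin N, τ / N := Finset.sum_le_sum_of_subset (Finset.subset_univ _)
      _ ≤ τ := by simpa using ENNReal.mul_div_le

/-- A finite emergence is attained by some family of centers. -/
lemma exists_centers {f : X → X} (hf : Measurable f) {μ : ProbabilityMeasure X} {ε : ℝ}
    (h : emergence f μ ε ≠ ⊤) :
    ∃ (N : ℕ) (c : Fin N → ProbabilityMeasure X), (N : ℕ∞) ≤ emergence f μ ε ∧
      ∫⁻ ν, (⨅ i, W₁ ν (c i)) ∂(ergodicDecomposition f hf μ : Measure (ProbabilityMeasure X)) ≤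
        ENNReal.ofReal ε := by
  -- In `ℕ∞`, an admissible `N` below the infimum plus one is at most the infimum.
  have hlt : emergence f μ ε < emergence f μ ε + 1 := (ENat.lt_add_one_iff h).2 le_rfl
  obtain ⟨N, hN⟩ := iInf_lt_iff.1 (show (⨅ _, _) < _ from hlt)
  obtain ⟨⟨c, -, hc⟩, hN⟩ := iInf_lt_iff.1 hN
  refine ⟨N, c, (ENat.lt_add_one_iff h).1 hN, ?_⟩
  rw [ergodicDecomposition, ProbabilityMeasure.toMeasure_map,
    lintegral_map (Measurable.iInf fun i => measurable_W₁_left (c i)) (measurable_empiricalLimit hf)]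
  exact hc

lemma localOrder_le {f : X → X} (hf : Measurable f) {μ ν : ProbabilityMeasure X} {t : ℝ}
    (h : ∀ᶠ x : ℝ in atTop, ENNReal.ofReal (Real.exp (-Real.exp (t * x))) ≤
      (ergodicDecomposition f hf μ : Measure (ProbabilityMeasure X))
        {ν' | W₁ ν ν' < ENNReal.ofReal (Real.exp (-x))}) :
    localOrder f hf μ ν ≤ t := by
  refine limsup_le_of_le (h := ?_)
  have htend : Tendsto (fun ε : ℝ => -Real.log ε) (𝓝[>] 0) atTop :=
    tendsto_neg_atBot_atTop.comp Real.tendsto_log_nhdsGT_zero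
  filter_upwards [htend.eventually h, htend.eventually (eventually_gt_atTop 0),
    self_mem_nhdsWithin] with ε hε hpos hε0
  rw [neg_neg, Real.exp_log hε0] at hε
  rw [EReal.div_le_iff_le_mul (EReal.coe_pos.2 hpos) (EReal.coe_ne_top _), ← EReal.coe_mul,
    mul_comm, ← Real.log_exp (t * _), ← ENNReal.log_ofReal_of_pos (Real.exp_pos _),
    ENNReal.log_le_log_iff, ← EReal.real_coe_toENNReal (Real.exp _)]
  refine EReal.toENNReal_le_toENNReal (EReal.neg_le.1 ?_)
  rw [← EReal.coe_neg, ← Real.log_exp (-Real.exp _), ← ENNReal.log_ofReal_of_pos (Real.exp_pos _)]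
  exact ENNReal.log_le_log hε

lemma localOrder_eq_bot {f : X → X} (hf : Measurable f) {μ ν : ProbabilityMeasure X}
    (h : ∀ᵐ ν' ∂(ergodicDecomposition f hf μ : Measure (ProbabilityMeasure X)),
      ∀ r : ℝ, 0 < r → W₁ ν ν' < ENNReal.ofReal r) :
    localOrder f hf μ ν = ⊥ := by
  refine le_bot_iff.1 (limsup_le_of_le (h := ?_))
  have htend : Tendsto (fun ε : ℝ => -Real.log ε) (𝓝[>] 0) atTop :=
    tendsto_neg_atBot_atTop.comp Real.tendsto_log_nhdsGT_zero
  filter_upwards [htend.eventually (eventually_gt_atTop 0), self_mem_nhdsWithin] with ε hpos hε0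
  -- Every ball has full mass, so the quotient is `log 0 = -∞` over a positive number.
  have h1 : (ergodicDecomposition f hf μ : Measure (ProbabilityMeasure X))
      {ν' | W₁ ν ν' < ENNReal.ofReal ε} = 1 :=
    (measure_congr (eventuallyEq_univ.2 (h.mono fun ν' hν' => hν' ε hε0))).trans measure_univ
  rw [h1, ENNReal.log_one, neg_zero, EReal.toENNReal_zero, ENNReal.log_zero,
    EReal.bot_div_of_pos_ne_top (EReal.coe_pos.2 hpos) (EReal.coe_ne_top _)]

/-- At the scales `exp (-k)`, almost every `ν` is close to a center of not too small mass. -/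
lemma ae_eventually_exists_center {f : X → X} (hf : Measurable f) {μ : ProbabilityMeasure X}
    {s b : ℝ} (h : emergenceOrder f μ < s) (hb : 1 < b) :
    ∃ (N : ℕ → ℕ) (c : (k : ℕ) → Fin (N k) → ProbabilityMeasure X),
      (∀ᶠ k : ℕ in atTop, (N k : ℝ≥0∞) ≤ ENNReal.ofReal (Real.exp (Real.exp (s * (b * k))))) ∧
      ∀ᵐ ν ∂(ergodicDecomposition f hf μ : Measure (ProbabilityMeasure X)), ∀ᶠ k : ℕ in atTop,
        ∃ i, W₁ ν (c k i) < ENNReal.ofReal (Real.exp (-k)) ∧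
          ENNReal.ofReal (Real.exp (-k)) / N k ≤
            (ergodicDecomposition f hf μ : Measure (ProbabilityMeasure X))
              {ν' | W₁ ν' (c k i) < ENNReal.ofReal (Real.exp (-k))} := by
  have htend : Tendsto (fun k : ℕ => b * (k : ℝ)) atTop atTop :=
    tendsto_natCast_atTop_atTop.const_mul_atTop (zero_lt_one.trans hb)
  have hE := htend.eventually (eventually_emergence_le h)
  have hex : ∀ k : ℕ, ∃ (N : ℕ) (c : Fin N → ProbabilityMeasure X),
      emergence f μ (Real.exp (-(b * k))) ≠ ⊤ →
        (N : ℕ∞) ≤ emergence f μ (Real.exp (-(b * k))) ∧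
        ∫⁻ ν, (⨅ i, W₁ ν (c i)) ∂(ergodicDecomposition f hf μ : Measure (ProbabilityMeasure X)) ≤
          ENNReal.ofReal (Real.exp (-(b * k))) := fun k => by
    by_cases hk : emergence f μ (Real.exp (-(b * k))) = ⊤
    · exact ⟨0, Fin.elim0, fun h' => absurd hk h'⟩
    · obtain ⟨N, c, hc⟩ := exists_centers hf hk
      exact ⟨N, c, fun _ => hc⟩
  choose N c hNc using hex
  have hfin : ∀ᶠ k : ℕ in atTop, emergence f μ (Real.exp (-(b * k))) ≠ ⊤ := by
    filter_upwards [hE] with k hk htop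
    rw [htop] at hk
    exact absurd hk (by simp)
  refine ⟨N, c, ?_, ?_⟩
  · filter_upwards [hE, hfin] with k hk hk'
    refine le_trans ?_ hk
    exact_mod_cast ENat.toENNReal_le.2 (hNc k hk').1
  -- The Markov term `exp (-b k) / exp (-k)` and the light-center term `τ = exp (-k)`.
  · refine ae_eventually_of_measure_le (u := fun k : ℕ =>
      ENNReal.ofReal (Real.exp (-((b - 1) * k))) + ENNReal.ofReal (Real.exp (-(1 * k)))) ?_ ?_
    · rw [ENNReal.tsum_add]
      exact ENNReal.add_ne_top.2 ⟨tsum_ofReal_exp_neg_mul_ne_top (sub_pos.2 hb),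
        tsum_ofReal_exp_neg_mul_ne_top one_pos⟩
    · filter_upwards [hfin] with k hk
      refine (measure_not_exists_center_le _ (c k) (ENNReal.ofReal (Real.exp (-k)))
        (hNc k hk).2 (by simp [Real.exp_pos]) ENNReal.ofReal_ne_top).trans (le_of_eq ?_)
      rw [← ENNReal.ofReal_div_of_pos (Real.exp_pos _), ← Real.exp_sub, one_mul]
      ring_nf

/-! ### Almost everywhere bounds on the local order -/

lemma two_mul_ofReal_exp_neg_le {x y : ℝ} (h : x + 1 ≤ y) :
    ENNReal.ofReal (Real.exp (-y)) + ENNReal.ofReal (Real.exp (-y)) ≤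
      ENNReal.ofReal (Real.exp (-x)) := by
  rw [← ENNReal.ofReal_add (Real.exp_pos _).le (Real.exp_pos _).le]
  refine ENNReal.ofReal_le_ofReal ?_
  have h1 : Real.exp (-x) = Real.exp (-y) * Real.exp (y - x) := by
    rw [← Real.exp_add]; ring_nf
  have h2 : 2 ≤ Real.exp (y - x) := by linarith [Real.add_one_le_exp (y - x)]
  nlinarith [Real.exp_pos (-y)]

lemma ae_localOrder_le_of_pos {f : X → X} (hf : Measurable f) {μ : ProbabilityMeasure X}
    {s t : ℝ} (hs : 0 < s) (hst : s < t) (h : emergenceOrder f μ < s) :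
    ∀ᵐ ν ∂(ergodicDecomposition f hf μ : Measure (ProbabilityMeasure X)),
      localOrder f hf μ ν ≤ t := by
  -- `b` is the midpoint of `1` and `t / s`, so that `s * b = (s + t) / 2 < t`.
  have hb : 1 < (1 + t / s) / 2 := by linarith [(one_lt_div hs).2 hst]
  have hsb : s * ((1 + t / s) / 2) < t := by
    have : s * (t / s) = t := mul_div_cancel₀ t hs.ne'
    linarith
  obtain ⟨N, c, hN, hae⟩ := ae_eventually_exists_center hf h hb
  filter_upwards [hae] with ν hν
  have hk : ∀ᶠ k : ℕ in atTop, ENNReal.ofReal (Real.exp (-Real.exp (t * (k - 2)))) ≤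
      (ergodicDecomposition f hf μ : Measure (ProbabilityMeasure X))
        {ν' | W₁ ν ν' < ENNReal.ofReal (Real.exp (-k)) + ENNReal.ofReal (Real.exp (-k))} := by
    filter_upwards [hN, hν, eventually_add_exp_le_exp hsb (hs.trans hst)] with k hNk hνk hk
    obtain ⟨i, hi, hmass⟩ := hνk
    calc ENNReal.ofReal (Real.exp (-Real.exp (t * (k - 2))))
        ≤ ENNReal.ofReal (Real.exp (-k)) /
            ENNReal.ofReal (Real.exp (Real.exp (s * ((1 + t / s) / 2 * k)))) := by
          rw [← ENNReal.ofReal_div_of_pos (Real.exp_pos _), ← Real.exp_sub]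
          refine ENNReal.ofReal_le_ofReal (Real.exp_le_exp.2 ?_)
          rw [← mul_assoc]
          linarith
      _ ≤ ENNReal.ofReal (Real.exp (-k)) / N k := by gcongr
      _ ≤ _ := hmass
      _ ≤ _ := measure_mono fun ν' hν' => (W₁_triangle ν (c k i) ν').trans_lt
          (ENNReal.add_lt_add hi (W₁_comm (c k i) ν' ▸ hν'))
  refine localOrder_le hf ?_
  -- With `k = ⌈x⌉₊ + 1`, the bound `x + 1 ≤ k` absorbs the doubled radius and `k - 2 ≤ x` controls
  -- the mass.
  have htend : Tendsto (fun x : ℝ => ⌈x⌉₊ + 1) atTop atTop :=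
    (tendsto_add_atTop_nat 1).comp tendsto_nat_ceil_atTop
  filter_upwards [htend.eventually hk, eventually_ge_atTop 0] with x hx hx0
  have hlow : x + 1 ≤ ((⌈x⌉₊ + 1 : ℕ) : ℝ) := by
    push_cast
    linarith [Nat.le_ceil x]
  have hupp : ((⌈x⌉₊ + 1 : ℕ) : ℝ) - 2 ≤ x := by
    push_cast
    linarith [Nat.ceil_lt_add_one hx0]
  refine le_trans (ENNReal.ofReal_le_ofReal (Real.exp_le_exp.2 (neg_le_neg
    (Real.exp_le_exp.2 (mul_le_mul_of_nonneg_left hupp (hs.trans hst).le))))) (hx.trans ?_)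
  exact measure_mono fun ν' hν' => lt_of_lt_of_le hν' (two_mul_ofReal_exp_neg_le hlow)

/-- For `s < 0` the bound `exp (exp (2 s k))` tends to `1`, so a single center eventually remains
and two typical points are both close to it at every small scale. -/
lemma ae_localOrder_eq_bot {f : X → X} (hf : Measurable f) {μ : ProbabilityMeasure X}
    (h : emergenceOrder f μ < 0) :
    ∀ᵐ ν ∂(ergodicDecomposition f hf μ : Measure (ProbabilityMeasure X)),
      localOrder f hf μ ν = ⊥ := by
  obtain ⟨s, hs, hs0⟩ := EReal.lt_iff_exists_real_btwn.1 h
  replace hs0 : s < 0 := by exact_mod_cast hs0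
  obtain ⟨N, c, hN, hae⟩ := ae_eventually_exists_center hf hs one_lt_two
  have hlim : Tendsto (fun k : ℕ => Real.exp (Real.exp (s * (2 * k)))) atTop (𝓝 (Real.exp 0)) := by
    refine (Real.continuous_exp.tendsto 0).comp (Real.tendsto_exp_atBot.comp ?_)
    exact (tendsto_natCast_atTop_atTop.const_mul_atTop two_pos).const_mul_atTop_of_neg hs0
  have hN1 : ∀ᶠ k in atTop, N k ≤ 1 := by
    filter_upwards [hN, hlim.eventually_lt_const (u := 2) (by simp)] with k hk hk2
    have h1 : (N k : ℝ) < 2 := by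
      rw [← ENNReal.ofReal_natCast, ENNReal.ofReal_le_ofReal_iff (Real.exp_pos _).le] at hk
      exact hk.trans_lt hk2
    have h2 : N k < 2 := by exact_mod_cast h1
    omega
  filter_upwards [hae] with ν hν
  refine localOrder_eq_bot hf ?_
  filter_upwards [hae] with ν' hν' r hr
  have hsmall : ∀ᶠ k : ℕ in atTop, -Real.log r + 1 ≤ (k : ℝ) :=
    tendsto_natCast_atTop_atTop.eventually_ge_atTop _
  obtain ⟨k, hNk, hk, ⟨i, hi, -⟩, ⟨j, hj, -⟩⟩ := (hN1.and (hsmall.and (hν.and hν'))).exists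
  have hij : j = i := by
    ext
    omega
  subst hij
  have hle := two_mul_ofReal_exp_neg_le hk
  rw [neg_neg, Real.exp_log hr] at hle
  exact ((W₁_triangle ν (c k j) ν').trans_lt
    (ENNReal.add_lt_add hi (W₁_comm (c k j) ν' ▸ hj))).trans_le hle

lemma ae_localOrder_le {f : X → X} (hf : Measurable f) {μ : ProbabilityMeasure X} {t : ℝ}
    (h : emergenceOrder f μ < t) :
    ∀ᵐ ν ∂(ergodicDecomposition f hf μ : Measure (ProbabilityMeasure X)),
      localOrder f hf μ ν ≤ t := by
  by_cases h0 : emergenceOrder f μ < 0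
  · filter_upwards [ae_localOrder_eq_bot hf h0] with ν hν
    rw [hν]
    exact bot_le
  · obtain ⟨s, hs, hst⟩ := EReal.lt_iff_exists_real_btwn.1 h
    exact ae_localOrder_le_of_pos hf (EReal.coe_pos.1 ((not_lt.1 h0).trans_lt hs))
      (EReal.coe_lt_coe_iff.1 hst) hs

end ErgodicEmergence

theorem mainTheorem5 {X : Type*} [MetricSpace X] [CompactSpace X] [MeasurableSpace X] [BorelSpace X]
    (f : X → X) (hf : Measurable f) (μ : ProbabilityMeasure X)
    (hμ : MeasurePreserving f (μ : Measure X) (μ : Measure X)) :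
    ∀ᵐ ν ∂(ErgodicEmergence.ergodicDecomposition f hf μ : Measure (ProbabilityMeasure X)),
      ErgodicEmergence.localOrder f hf μ ν ≤ ErgodicEmergence.emergenceOrder f μ := by
  -- Rational thresholds give one null set valid for all of them, and they separate any two extended
  -- reals.
  have hall : ∀ᵐ ν ∂(ErgodicEmergence.ergodicDecomposition f hf μ : Measure (ProbabilityMeasure X)),
      ∀ q : ℚ, ErgodicEmergence.emergenceOrder f μ < ((q : ℝ) : EReal) →
        ErgodicEmergence.localOrder f hf μ ν ≤ ((q : ℝ) : EReal) := by
    refine ae_all_iff.2 fun q => ?_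
    by_cases hq : ErgodicEmergence.emergenceOrder f μ < ((q : ℝ) : EReal)
    · filter_upwards [ErgodicEmergence.ae_localOrder_le hf hq] with ν hν _ using hν
    · exact ae_of_all _ fun ν h => absurd h hq
  filter_upwards [hall] with ν hν
  refine not_lt.1 fun hlt => ?_
  obtain ⟨q, hq, hq'⟩ := EReal.lt_iff_exists_rat_btwn.1 hlt
  exact (hν q hq).not_gt hq'
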